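/- Let $X$ be a complex Banach space, $L(X)$ the algebra of bounded linear operators on $X$, $K(X)\subseteq L(X)$ the closed ideal of compact operators, $C(X)=L(X)/K(X)$ the Calkin algebra and $\pi\colon L(X)\to C(X)$ the quotient map. For a complex unital Banach algebra $A$, an element $w\in A$ is quasinilpotent if its spectral radius is $0$. Let $A^{D}$ be the set of Drazin invertible elements, i.e. of those $a\in A$ for which there are $b\in A$ and $m\in\mathbb N$ with $ab=ba$, $bab=b$ and $a^mba=a^m$. Let $A^{KD}$ be the set of Koliha-Drazin invertible elements, i.e. of those $a\in A$ for which there are $b\in A$ and a quasinilpotent $w\in A$ with $ab=ba$, $bab=b$ and $aba=a+w$. An operator $T\in L(X)$ is Riesz if $\pi(T)$ is quasinilpotent in $C(X)$, power compact if $T^n\in K(X)$ for some $n\ge 1$, and Fredholm if its range is closed and its kernel and cokernel are finite-dimensional. Let $RF(X)$ (respectively $PKF(X)$) be the set of Riesz-Fredholm (respectively power compact-Fredholm) operators, i.e. of those $T\in L(X)$ for which there are closed $T$-invariant subspaces $M,N$ of $X$ with $X=M\oplus N$ such that $T|_M\in L(M)$ is Riesz (respectively power compact) and $T|_N\in L(N)$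 is Fredholm. Then: (i) $\pi(RF(X))=C(X)^{KD}$; equivalently, $\pi^{-1}(C(X)^{KD})=RF(X)+K(X)$. (ii) $\pi(PKF(X))=C(X)^{D}$; equivalently, $\pi^{-1}(C(X)^{D})=PKF(X)+K(X)$. -/

import Mathlib

open scoped Pointwise

namespace CalkinDrazin

/-! ### Drazin and Koliha-Drazin invertibility in a complex unital algebra -/

section Algebra

variable {A : Type*} [Ring A] [Algebra ℂ A]

/-- Quasinilpotent elements: those of spectral radius zero, i.e. with no nonzero spectral value. -/
def IsQuasinilpotent (a : A) : Prop := spectralRadius ℂ a = 0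

/-- Quasinilpotency means that the spectrum has no point other than zero. -/
theorem isQuasinilpotent_iff (a : A) : IsQuasinilpotent a ↔ spectrum ℂ a ⊆ {0} := by
  simp [IsQuasinilpotent, spectralRadius, Set.subset_def]

/-- The set `A^D` of Drazin invertible elements of `A`. -/
def drazinInvertible (A : Type*) [Ring A] : Set A :=
  {a | ∃ (b : A) (m : ℕ), a * b = b * a ∧ b * a * b = b ∧ a ^ m * b * a = a ^ m}

/-- The set `A^{KD}` of Koliha-Drazin (generalized Drazin) invertible elements of `A`. -/
def kolihaDrazinInvertible (A : Type*) [Ring A] [Algebra ℂ A] : Set A :=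
  {a | ∃ b w : A, a * b = b * a ∧ b * a * b = b ∧ a * b * a = a + w ∧ IsQuasinilpotent w}

end Algebra

/-! ### The Calkin algebra -/

section Operators

variable (X : Type*) [NormedAddCommGroup X] [NormedSpace ℂ X]

/-- The ideal `K(X)` of compact operators in the algebra of bounded operators on `X`. -/
def compactIdeal : Ideal (X →L[ℂ] X) where
  carrier := {T | IsCompactOperator T}
  add_mem' hS hT := hS.add hT
  zero_mem' := isCompactOperator_zero
  smul_mem' S _ hT := hT.clm_comp S

instance : (compactIdeal X).IsTwoSided where
  mul_mem_of_left S hT := IsCompactOperator.comp_clm hT S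

/-- The Calkin algebra `C(X) = L(X) / K(X)`. -/
abbrev Calkin : Type _ := (X →L[ℂ] X) ⧸ compactIdeal X

/-- The quotient map `π : L(X) → C(X)`. -/
abbrev calkinMap : (X →L[ℂ] X) →ₐ[ℂ] Calkin X := Ideal.Quotient.mkₐ ℂ (compactIdeal X)

variable {X}

/-! ### Riesz, power compact, Riesz-Fredholm and power compact-Fredholm operators -/

/-- `T` is a Riesz operator: its coset in the Calkin algebra is quasinilpotent. -/
def IsRiesz (T : X →L[ℂ] X) : Prop := IsQuasinilpotent (calkinMap X T)

/-- `T` is power compact: some power of `T` is a compact operator. -/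
def IsPowerCompact (T : X →L[ℂ] X) : Prop := ∃ n : ℕ, 1 ≤ n ∧ IsCompactOperator (T ^ n)

/-- On a Banach space, Mathlib's Fredholm operators are exactly the operators with closed range
and finite-dimensional kernel and cokernel. -/
theorem isFredholm_iff [CompleteSpace X] (T : X →L[ℂ] X) :
    T.IsFredholm ↔ IsClosed (T.range : Set X) ∧ FiniteDimensional ℂ T.ker ∧
      FiniteDimensional ℂ (X ⧸ T.range) := by
  refine ⟨fun h => ⟨h.isClosed_range, h.finite_ker, h.finite_coker⟩,
    fun ⟨h1, h2, h3⟩ => ⟨?_, h1, h2, h3, Submodule.ClosedComplemented.of_finiteDimensional _⟩⟩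
  have : CompleteSpace T.range := h1.completeSpace_coe
  have hs : Function.Surjective T.rangeRestrict := fun ⟨y, x, hx⟩ => ⟨x, Subtype.ext hx⟩
  exact T.rangeRestrict.isQuotientMap hs

variable (X)

/-- The Riesz-Fredholm operators `RF(X)`: there are closed `T`-invariant subspaces `M`, `N` with
`X = M ⊕ N` such that `T|_M` is Riesz and `T|_N` is Fredholm. -/
def rieszFredholm : Set (X →L[ℂ] X) :=
  {T | ∃ M N : Submodule ℂ X, IsClosed (M : Set X) ∧ IsClosed (N : Set X) ∧ IsCompl M N ∧
    ∃ (hM : ∀ x ∈ M, T x ∈ M) (hN : ∀ x ∈ N, T x ∈ N),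
      IsRiesz (T.restrict hM) ∧ (T.restrict hN).IsFredholm}

/-- The power compact-Fredholm operators `PKF(X)`: there are closed `T`-invariant subspaces
`M`, `N` with `X = M ⊕ N` such that `T|_M` is power compact and `T|_N` is Fredholm. -/
def powerCompactFredholm : Set (X →L[ℂ] X) :=
  {T | ∃ M N : Submodule ℂ X, IsClosed (M : Set X) ∧ IsClosed (N : Set X) ∧ IsCompl M N ∧
    ∃ (hM : ∀ x ∈ M, T x ∈ M) (hN : ∀ x ∈ N, T x ∈ N),
      IsPowerCompact (T.restrict hM) ∧ (T.restrict hN).IsFredholm}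

end Operators

end CalkinDrazin

/-!
Write `π : L(X) → C(X)` for the quotient map. A decomposition `X = M ⊕ N` reducing `T`, with `T|_N`
Fredholm, gives a (Koliha-)Drazin inverse of `π T`: by Atkinson's theorem (`isFredholm_iff_isUnit`)
`T|_N` is invertible modulo compacts, and its inverse there, extended by zero on `M`, does the job.
The defect `1 - ab` is the class of the projection onto `M`, so that the rest of `π T` is the class
of `T|_M` extended by zero; it is quasinilpotent, or nilpotent, exactly when `T|_M` is Riesz
(`isRiesz_iff_corner`), or power compact (`calkinMap_pow_mul_corner_one_eq_zero_iff`).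

Conversely, if `b` is an inverse of `a = π T₀` then `ab` is an idempotent of `C(X)` commuting with
`a`. It lifts to an idempotent operator `E` (`exists_idempotent_lift`), and
`T = E T₀ E + (1 - E) T₀ (1 - E)` is another representative of `a`; it is reduced by `ker E` and
`range E` (`exists_reducing_representative`), and the dictionary above applies. The statements on
preimages follow from those on images, because `π⁻¹(π(s)) = s + K(X)`.

To lift an idempotent, let `K = T² - T` be compact. Only finitely many eigenvalues of `K` lie outside
a small disc, and the corresponding Riesz idempotent `Q` is compact and commutes with `T`; replacing
`T` by `T(1 - Q)` makes the spectral radius of `K` less than `1/4`. Then `u² + u = K` has a solution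
`u ∈ K · L(X)`, given by the generating function of the Catalan numbers, `1 + 2u` is invertible, and
`(T + u)(1 + 2u)⁻¹` is an idempotent congruent to `T` modulo compacts.

The Riesz idempotents come from Mathlib's Fredholm alternative. If `S` is a power of `1 - K` with
`ker S² = ker S`, and `P` is a projection onto the finite-dimensional space `ker S`, then `S + P` is
injective, hence invertible, which forces `X = ker S ⊕ range S`.
-/

namespace CalkinDrazin

open Module.End LinearMap.FiniteRangeSetoid

/-! ### Quasinilpotent elements -/

section Quasinilpotent

theorem isQuasinilpotent_iff_isUnit {A : Type*} [Ring A] [Algebra ℂ A] {a : A} :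
    IsQuasinilpotent a ↔ ∀ z : ℂ, z ≠ 0 → IsUnit (z • 1 - a) := by
  rw [isQuasinilpotent_iff, Set.subset_def]
  refine forall_congr' fun z => ?_
  rw [spectrum.mem_iff, Algebra.algebraMap_eq_smul_one, Set.mem_singleton_iff, ← not_imp_not,
    not_not]

theorem IsQuasinilpotent.neg {A : Type*} [Ring A] [Algebra ℂ A] {a : A}
    (ha : IsQuasinilpotent a) : IsQuasinilpotent (-a) := by
  rw [isQuasinilpotent_iff_isUnit] at ha ⊢
  intro z hz
  rw [← IsUnit.neg_iff]
  convert ha (-z) (neg_ne_zero.mpr hz) using 1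
  rw [neg_smul]; abel

end Quasinilpotent

/-! ### The quadratic equation in a Banach algebra -/

section BanachAlgebra

open Filter Topology ENNReal NNReal

variable {A : Type*} [NormedRing A] [NormedAlgebra ℂ A] [CompleteSpace A]

/-- The Catalan numbers are at most `4 ^ n`, so by Gelfand's formula their generating function
converges at elements of spectral radius less than `1/4`. -/
theorem summable_norm_catalan_smul_pow {k : A} (hk : spectralRadius ℂ k < 4⁻¹) :
    Summable fun n : ℕ => ‖(catalan n : ℂ) • (-k) ^ n‖ := by
  obtain ⟨r, hr, hr4⟩ := ENNReal.lt_iff_exists_nnreal_btwn.mp hk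
  have hr4' : (r : ℝ) < 4⁻¹ := by
    rw [show (4⁻¹ : ℝ≥0∞) = ((4⁻¹ : ℝ≥0) : ℝ≥0∞) by norm_num, ENNReal.coe_lt_coe] at hr4
    exact_mod_cast hr4
  have hev := (spectrum.pow_nnnorm_pow_one_div_tendsto_nhds_spectralRadius k).eventually_lt_const hr
  have hgeo : Summable fun n : ℕ => (4 * (r : ℝ)) ^ n :=
    summable_geometric_of_lt_one (by positivity) (by linarith)
  refine Summable.of_norm_bounded_eventually_nat hgeo ?_
  filter_upwards [hev, eventually_gt_atTop 0] with n hn hn0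
  have hkn : ‖k ^ n‖ ≤ (r : ℝ) ^ n := by
    have h1 : ((‖k ^ n‖₊ : ℝ≥0∞) ^ (1 / n : ℝ)) ^ n ≤ (r : ℝ≥0∞) ^ n := by gcongr
    rw [← ENNReal.rpow_natCast, ← ENNReal.rpow_mul, one_div_mul_cancel (by positivity),
      ENNReal.rpow_one] at h1
    exact_mod_cast h1
  have hcat : (catalan n : ℝ) ≤ 4 ^ n := by
    have h1 : catalan n ≤ (n + 1) * catalan n := Nat.le_mul_of_pos_left _ n.succ_pos
    rw [succ_mul_catalan_eq_centralBinom] at h1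
    exact_mod_cast h1.trans (Nat.centralBinom_le_four_pow n)
  have hneg : ‖(-k) ^ n‖ = ‖k ^ n‖ := by
    rw [neg_pow]
    rcases neg_one_pow_eq_or A n with h | h <;> simp [h]
  rw [norm_norm, norm_smul, hneg, mul_pow]
  simp only [RCLike.norm_natCast]
  gcongr

/-- If `k` has spectral radius less than `1/4`, the equation `u² + u = k` has a solution `u = k c`
with `1 + 2u` invertible. Here `c = ∑ Cₙ (-k)ⁿ` with `Cₙ` the Catalan numbers, whose recursion reads
`c = 1 - k c²`. -/
theorem exists_quadratic_root {k : A} (hk : spectralRadius ℂ k < 4⁻¹) :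
    ∃ c : A, (∀ t, Commute t k → Commute t c) ∧ k * c * (k * c) + k * c = k ∧
      IsUnit (1 + 2 * (k * c)) := by
  have hs := summable_norm_catalan_smul_pow hk
  set f : ℕ → A := fun n => (catalan n : ℂ) • (-k) ^ n with hf
  have hcom (t : A) (ht : Commute t k) : Commute t (∑' n, f n) :=
    Commute.tsum_right _ fun n => ((ht.neg_right).pow_right n).smul_right _
  have hconv (n : ℕ) : ∑ p ∈ Finset.HasAntidiagonal.antidiagonal n, f p.1 * f p.2 =
      (catalan (n + 1) : ℂ) • (-k) ^ n := by
    rw [catalan_succ', Nat.cast_sum, Finset.sum_smul]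
    refine Finset.sum_congr rfl fun p hp => ?_
    rw [← Finset.HasAntidiagonal.mem_antidiagonal.mp hp]
    simp only [hf, smul_mul_smul_comm, pow_add, Nat.cast_mul]
  have hsq : (∑' n, f n) * (∑' n, f n) = ∑' n, (catalan (n + 1) : ℂ) • (-k) ^ n := by
    rw [tsum_mul_tsum_eq_tsum_sum_antidiagonal_of_summable_norm hs hs]
    exact tsum_congr hconv
  have hs' : Summable fun n => (catalan (n + 1) : ℂ) • (-k) ^ n :=
    (summable_norm_sum_mul_antidiagonal_of_summable_norm hs hs).of_norm.congr hconv
  have hrec : ∑' n, f n = 1 - k * ((∑' n, f n) * (∑' n, f n)) := by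
    rw [hsq, hs.of_norm.tsum_eq_zero_add, sub_eq_add_neg, ← neg_mul, ← hs'.tsum_mul_left]
    congr 1
    · simp
    · congr 1
      ext n
      rw [mul_smul_comm, ← pow_succ']
  set c := ∑' n, f n
  have hck : c * k = k * c := (hcom k (Commute.refl k)).eq.symm
  have hroot : k * c * (k * c) + k * c = k := by
    have h1 : k * c * (k * c) = k * (k * (c * c)) := by
      rw [mul_assoc, ← mul_assoc c, hck]; simp only [mul_assoc]
    rw [h1, ← mul_add]
    conv_lhs => enter [2, 2]; rw [hrec]
    simp
  refine ⟨c, hcom, hroot, ?_⟩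
  have hres : (-4⁻¹ : ℂ) ∈ resolventSet ℂ k := by
    apply spectrum.mem_resolventSet_of_spectralRadius_lt
    convert hk using 1
    simp
  -- `1 + 2u` is a square root of `1 + 4k`, which is invertible because `-1/4` is not in the
  -- spectrum of `k`.
  have hsq2 : (1 + 2 * (k * c)) ^ 2 = 1 + 4 * k := by
    conv_rhs => rw [← hroot]
    noncomm_ring
  rw [← isUnit_pow_iff two_ne_zero, hsq2]
  rw [spectrum.mem_resolventSet_iff] at hres
  have h4 : (1 : A) + 4 * k = (Units.mk0 (-4 : ℂ) (by norm_num)) •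
      (algebraMap ℂ A (-4⁻¹) - k) := by
    rw [Units.smul_def, Units.val_mk0, smul_sub, Algebra.algebraMap_eq_smul_one, smul_smul]
    have : (4 : A) * k = (4 : ℂ) • k := by
      rw [Algebra.smul_def, map_ofNat]
    rw [this]
    norm_num
  rw [h4]
  exact (isUnit_smul_iff _ _).mpr hres

end BanachAlgebra

/-! ### The quotient map onto the Calkin algebra -/

section Calkin

variable {X : Type*} [NormedAddCommGroup X] [NormedSpace ℂ X]

theorem calkinMap_eq_iff {S T : X →L[ℂ] X} :
    calkinMap X S = calkinMap X T ↔ IsCompactOperator (S - T : X →L[ℂ] X) :=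
  Ideal.Quotient.eq

theorem calkinMap_eq_zero_iff {T : X →L[ℂ] X} :
    calkinMap X T = 0 ↔ IsCompactOperator T :=
  Ideal.Quotient.eq_zero_iff_mem

theorem calkinMap_surjective : Function.Surjective (calkinMap X) :=
  Ideal.Quotient.mk_surjective

theorem preimage_image_calkinMap (s : Set (X →L[ℂ] X)) :
    calkinMap X ⁻¹' (calkinMap X '' s) = s + (compactIdeal X : Set (X →L[ℂ] X)) := by
  ext T
  constructor
  · rintro ⟨S, hS, hST⟩
    exact ⟨S, hS, T - S, calkinMap_eq_iff.mp hST.symm, add_sub_cancel S T⟩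
  · rintro ⟨S, hS, K, hK, rfl⟩
    refine ⟨S, hS, ?_⟩
    change _ = calkinMap X (S + K)
    rw [map_add, calkinMap_eq_zero_iff.mpr hK, add_zero]

end Calkin

/-! ### Riesz theory of compact operators and Atkinson's theorem -/

section Riesz

variable {X : Type*} [NormedAddCommGroup X] [NormedSpace ℂ X]

/-- The compactness argument of Riesz theory: there is no strictly increasing chain of closed
subspaces `W n` such that `K - μ n` maps `W (n + 1)` into `W n`, with `μ n` bounded away from zero.
By Riesz's lemma, such a chain would contain a bounded sequence whose image under `K` is
separated. -/
theorem _root_.IsCompactOperator.not_strictMono_closed_chain {K : X →L[ℂ] X}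
    (hK : IsCompactOperator K) {W : ℕ → Submodule ℂ X} (hW : StrictMono W)
    (hcl : ∀ n, IsClosed (W n : Set X)) {μ : ℕ → ℂ} {ε : ℝ} (hε : 0 < ε)
    (hμ : ∀ n, ε ≤ ‖μ n‖) (h : ∀ n, ∀ x ∈ W (n + 1), K x - μ n • x ∈ W n) : False := by
  have key (n : ℕ) : ∃ x ∈ W (n + 1), ‖x‖ ≤ 3 ∧ ∀ y ∈ W n, 1 ≤ ‖x - y‖ := by
    have h₁ : IsClosed ((W n).comap (W (n + 1)).subtype : Set (W (n + 1))) :=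
      (hcl n).preimage continuous_subtype_val
    have h₂ : ∃ x : W (n + 1), x ∉ (W n).comap (W (n + 1)).subtype := by
      obtain ⟨x, hx, hx'⟩ := SetLike.exists_of_lt (hW (Nat.lt_succ_self n))
      exact ⟨⟨x, hx⟩, hx'⟩
    obtain ⟨x, hx, hxy⟩ := riesz_lemma_of_norm_lt (𝕜 := ℂ) (c := 2) (R := 3)
      (by norm_num) (by norm_num) h₁ h₂
    exact ⟨x, x.2, hx, fun y hy => hxy ⟨y, hW.monotone (Nat.le_succ n) hy⟩ hy⟩
  choose x hxW hx3 hxd using key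
  have hsep : ∀ m n, m < n → ε ≤ ‖K (x n) - K (x m)‖ := by
    intro m n hmn
    have hxm : x m ∈ W n := hW.monotone hmn (hxW m)
    have hKm : K (x m) ∈ W n := by
      have h1 := (W n).add_mem (hW.monotone hmn.le (h m _ (hxW m))) ((W n).smul_mem (μ m) hxm)
      simpa using h1
    have h0 : μ n ≠ 0 := norm_pos_iff.mp (hε.trans_le (hμ n))
    have hy : (μ n)⁻¹ • (K (x m) - (K (x n) - μ n • x n)) ∈ W n :=
      (W n).smul_mem _ ((W n).sub_mem hKm (h n _ (hxW n)))
    have he : K (x n) - K (x m) =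
        μ n • (x n - (μ n)⁻¹ • (K (x m) - (K (x n) - μ n • x n))) := by
      rw [smul_sub, smul_inv_smul₀ h0]; abel
    rw [he, norm_smul]
    exact (hμ n).trans (le_mul_of_one_le_right (norm_nonneg _) (hxd n _ hy))
  obtain ⟨C, hC, hC'⟩ := hK.image_closedBall_subset_compact 3
  obtain ⟨y, -, ψ, hψ, hψy⟩ := hC.tendsto_subseq
    (fun n => hC' ⟨x n, by simpa using hx3 n, rfl⟩)
  have hcs := hψy.cauchySeq
  rw [Metric.cauchySeq_iff'] at hcs
  obtain ⟨N, hN⟩ := hcs ε hε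
  have h1 := hN (N + 1) (Nat.le_succ N)
  rw [dist_eq_norm] at h1
  exact (hsep _ _ (hψ (Nat.lt_succ_self N))).not_gt h1

/-- Eigenvectors for infinitely many eigenvalues outside a disc would span a chain excluded by
`IsCompactOperator.not_strictMono_closed_chain`. -/
theorem _root_.IsCompactOperator.finite_eigenvalues_norm_ge {K : X →L[ℂ] X}
    (hK : IsCompactOperator K) {ε : ℝ} (hε : 0 < ε) :
    {μ : ℂ | HasEigenvalue (K : Module.End ℂ X) μ ∧ ε ≤ ‖μ‖}.Finite := by
  by_contra hinf
  let μ := Set.Infinite.natEmbedding _ hinf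
  choose v hv using fun n => (μ n).2.1.exists_hasEigenvector
  have hli : LinearIndependent ℂ v := eigenvectors_linearIndependent' (K : Module.End ℂ X)
    (fun n => (μ n : ℂ)) (Subtype.val_injective.comp μ.injective) v hv
  have hmem {i n : ℕ} (hin : i < n) : v i ∈ Submodule.span ℂ (v '' Set.Iio n) :=
    Submodule.subset_span ⟨i, hin, rfl⟩
  refine hK.not_strictMono_closed_chain (W := fun n => Submodule.span ℂ (v '' Set.Iio n))
    (μ := fun n => μ n) (strictMono_nat_of_lt_succ fun n => ?_) (fun n => ?_) hε
    (fun n => (μ n).2.2) fun n x hx => ?_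
  · refine lt_of_le_of_ne (Submodule.span_mono (Set.image_mono (Set.Iio_subset_Iio n.le_succ)))
      fun he => ?_
    have := hmem (Nat.lt_succ_self n)
    rw [← he] at this
    exact hli.notMem_span_image (s := Set.Iio n) (by simp) this
  · have : FiniteDimensional ℂ (Submodule.span ℂ (v '' Set.Iio n)) :=
      FiniteDimensional.span_of_finite ℂ ((Set.finite_Iio n).image v)
    exact Submodule.closed_of_finiteDimensional _
  · induction hx using Submodule.span_induction with
    | mem x hx =>
      obtain ⟨i, hi, rfl⟩ := hx
      have hKv : K (v i) = (μ i : ℂ) • v i := (hv i).apply_eq_smul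
      rw [hKv, ← sub_smul]
      rcases Nat.lt_succ_iff_lt_or_eq.mp hi with hlt | rfl
      · exact Submodule.smul_mem _ _ (hmem hlt)
      · simp
    | zero => simp
    | add x y _ _ hx hy =>
      convert Submodule.add_mem _ hx hy using 1
      simp only [map_add, smul_add]; abel
    | smul c x _ hx =>
      convert Submodule.smul_mem _ c hx using 1
      simp only [map_smul, smul_sub, smul_comm c]

theorem one_sub_pow_eq_one_sub {K : X →L[ℂ] X} (hK : IsCompactOperator K) (n : ℕ) :
    ∃ L : X →L[ℂ] X, IsCompactOperator L ∧ (1 - K) ^ n = 1 - L := by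
  refine ⟨1 - (1 - K) ^ n, ?_, by abel⟩
  change 1 - (1 - K) ^ n ∈ compactIdeal X
  rw [← Ideal.Quotient.eq]
  have hK0 : Ideal.Quotient.mk (compactIdeal X) K = 0 := Ideal.Quotient.eq_zero_iff_mem.mpr hK
  simp [hK0]

theorem exists_ker_one_sub_pow_stable {K : X →L[ℂ] X} (hK : IsCompactOperator K) :
    ∃ n, ∀ x, ((1 - K) ^ (n + 1) : X →L[ℂ] X) x = 0 → ((1 - K) ^ n : X →L[ℂ] X) x = 0 := by
  by_contra! hne
  refine hK.not_strictMono_closed_chain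
    (W := fun n => (((1 - K) ^ n : X →L[ℂ] X) : X →ₗ[ℂ] X).ker) (μ := fun _ => 1)
    (strictMono_nat_of_lt_succ fun n => ?_)
    (fun n => ((1 - K) ^ n : X →L[ℂ] X).isClosed_ker) one_pos (by simp) fun n x hx => ?_
  · obtain ⟨x, hx, hx'⟩ := hne n
    refine SetLike.lt_iff_le_and_exists.mpr ⟨fun y hy => ?_, x, hx, hx'⟩
    have hy' : ((1 - K) ^ n) y = 0 := hy
    change ((1 - K) ^ (n + 1)) y = 0
    rw [pow_succ', mul_apply_eq_comp, hy', map_zero]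
  · have hx' : ((1 - K) ^ (n + 1)) x = 0 := hx
    rw [pow_succ, mul_apply_eq_comp] at hx'
    change ((1 - K) ^ n) (K x - (1 : ℂ) • x) = 0
    have : K x - (1 : ℂ) • x = -((1 - K) x) := by simp
    rw [this, map_neg, hx', neg_zero]

theorem finiteDimensional_ker_one_sub {K : X →L[ℂ] X} (hK : IsCompactOperator K) :
    FiniteDimensional ℂ (1 - K : X →L[ℂ] X).ker := by
  have hmem (x : X) (hx : x ∈ (1 - K : X →L[ℂ] X).ker) : K x = x := by
    have : (1 - K) x = 0 := hx
    exact (sub_eq_zero.mp this).symm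
  have := hK.restrict (f := (K : X →ₗ[ℂ] X)) (V := (1 - K : X →L[ℂ] X).ker)
    (fun x hx => by rwa [ContinuousLinearMap.coe_coe, hmem x hx]) (1 - K : X →L[ℂ] X).isClosed_ker
  have he : ⇑((K : X →ₗ[ℂ] X).restrict fun x hx =>
      (by rwa [ContinuousLinearMap.coe_coe, hmem x hx] :
      (K : X →ₗ[ℂ] X) x ∈ (1 - K : X →L[ℂ] X).ker)) = id :=
    funext fun x => Subtype.ext (hmem x x.2)
  rw [he] at this
  exact FiniteDimensional.of_isCompactOperator_id (𝕜 := ℂ) this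

theorem hasFiniteRange_of_compact_idempotent {Q : X →L[ℂ] X} (hQ : IsCompactOperator Q)
    (hQQ : Q * Q = Q) : (Q : X →ₗ[ℂ] X).HasFiniteRange := by
  have hfin := finiteDimensional_ker_one_sub hQ
  have hle : (Q : X →ₗ[ℂ] X).range ≤ (1 - Q : X →L[ℂ] X).ker := by
    rintro _ ⟨x, rfl⟩
    have h : Q (Q x) = Q x := congrArg (fun U : X →L[ℂ] X => U x) hQQ
    change (1 - Q) (Q x) = 0
    simp [h]
  have := Submodule.finiteDimensional_of_le hle
  exact Module.Finite.iff_fg.mp this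

theorem isCompactOperator_of_hasFiniteRange {U : X →L[ℂ] X}
    (hU : (U : X →ₗ[ℂ] X).HasFiniteRange) : IsCompactOperator U := by
  have : FiniteDimensional ℂ (U : X →ₗ[ℂ] X).range := Module.Finite.iff_fg.mpr hU
  have hid : IsCompactOperator (id : (U : X →ₗ[ℂ] X).range → _) :=
    isCompactOperator_id_iff_finiteDimensional (𝕜 := ℂ) |>.mpr this
  exact (hid.comp_clm (U.codRestrict _ fun x => ⟨x, rfl⟩)).clm_comp
    (U : X →ₗ[ℂ] X).range.subtypeL

variable [CompleteSpace X]

theorem isUnit_one_sub_of_injective {K : X →L[ℂ] X} (hK : IsCompactOperator K)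
    (h : ∀ x, (1 - K) x = 0 → x = 0) : IsUnit (1 - K) := by
  rcases hK.hasEigenvalue_or_mem_resolventSet one_ne_zero with h1 | h1
  · obtain ⟨v, hv⟩ := h1.exists_hasEigenvector
    have hKv : K v = (1 : ℂ) • v := hv.apply_eq_smul
    exact absurd (h v (by simp [hKv])) hv.2
  · simpa [spectrum.mem_resolventSet_iff] using h1

/-- The Riesz idempotent of a compact operator `K` at the spectral point `1`: `1 - K` is nilpotent
on the range of `Q` and invertible on its kernel. -/
theorem exists_riesz_idempotent {K : X →L[ℂ] X} (hK : IsCompactOperator K) :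
    ∃ (n : ℕ) (Q : X →L[ℂ] X), IsCompactOperator Q ∧ Q * Q = Q ∧ (1 - K) ^ (n + 1) * Q = 0 ∧
      IsUnit ((1 - K) ^ (n + 1) + Q) ∧ ∀ T : X →L[ℂ] X, Commute T K → Commute T Q := by
  obtain ⟨n, hn⟩ := exists_ker_one_sub_pow_stable hK
  -- The kernels of the powers of `1 - K` are constant from `n` on.
  have hn' (k : ℕ) : ∀ x, ((1 - K) ^ (n + k) : X →L[ℂ] X) x = 0 →
      ((1 - K) ^ n : X →L[ℂ] X) x = 0 := by
    induction k with
    | zero => exact fun x hx => hx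
    | succ k ih =>
      intro x hx
      apply ih
      rw [pow_add]
      refine hn (((1 - K) ^ k : X →L[ℂ] X) x) ?_
      rwa [show n + (k + 1) = n + 1 + k by ring, pow_add] at hx
  set S : X →L[ℂ] X := (1 - K) ^ (n + 1) with hS
  have hSS : ∀ x, S (S x) = 0 → S x = 0 := by
    intro x hx
    have hx2 : ((1 - K) ^ (n + (n + 2)) : X →L[ℂ] X) x = 0 := by
      rwa [show n + (n + 2) = n + 1 + (n + 1) by ring, pow_add]
    rw [hS, pow_succ', mul_apply_eq_comp, hn' _ x hx2, map_zero]
  obtain ⟨L, hL, hSL⟩ := one_sub_pow_eq_one_sub hK (n + 1)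
  rw [← hS] at hSL
  have hfin : FiniteDimensional ℂ S.ker := by rw [hSL]; exact finiteDimensional_ker_one_sub hL
  obtain ⟨ρ, hρ⟩ := Submodule.ClosedComplemented.of_finiteDimensional S.ker
  let P : X →L[ℂ] X := S.ker.subtypeL ∘L ρ
  have hPmem (x : X) : S (P x) = 0 := (ρ x).2
  have hPid (x : X) (hx : S x = 0) : P x = x := congrArg Subtype.val (hρ ⟨x, hx⟩)
  have hcomp (U : X →L[ℂ] S.ker) : IsCompactOperator (S.ker.subtypeL ∘L U) := by
    have := isCompactOperator_id_iff_finiteDimensional (𝕜 := ℂ) |>.mpr hfin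
    exact (this.comp_clm U).clm_comp S.ker.subtypeL
  -- Adding any idempotent with range `ker S` makes `S` injective, hence invertible.
  have hunit (R : X →L[ℂ] X) (hRc : IsCompactOperator R) (hRS : ∀ x, S (R x) = 0)
      (hRid : ∀ x, S x = 0 → R x = x) : IsUnit (S + R) := by
    have he : S + R = 1 - (L - R) := by rw [hSL]; abel
    rw [he]
    refine isUnit_one_sub_of_injective (hL.sub hRc) fun x hx => ?_
    rw [← he, add_apply] at hx
    have hSx : S x = 0 := hSS x (by
      rw [eq_neg_of_add_eq_zero_left hx, map_neg, hRS, neg_zero])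
    rw [hSx, zero_add, hRid x hSx] at hx
    exact hx
  obtain ⟨V, hV⟩ := hunit P (hcomp ρ) hPmem hPid
  -- `x = S (B x) + P (B x)` decomposes `x` along `range S ⊕ ker S`, so `Q = P B` is the projection
  -- onto `ker S` along `range S`.
  let B : X →L[ℂ] X := ↑V⁻¹
  have hB (x : X) : S (B x) + P (B x) = x := by
    rw [← add_apply, ← hV, ← mul_apply_eq_comp, V.mul_inv]; rfl
  let Q : X →L[ℂ] X := P * B
  have hQS (x : X) : S (Q x) = 0 := hPmem _
  have hQid (x : X) (hx : S x = 0) : Q x = x := by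
    have h1 := hB x
    have h2 : S (B x) = 0 := hSS _ (by
      have := congrArg S h1
      rwa [map_add, hPmem, add_zero, hx] at this)
    rwa [h2, zero_add] at h1
  have hQran (x : X) : Q (S x) = 0 := by
    have h1 : S (B (S x) - x) = - P (B (S x)) := by
      rw [map_sub, eq_sub_of_add_eq (hB (S x))]; abel
    have h2 : S (B (S x) - x) = 0 := hSS _ (by rw [h1, map_neg, hPmem, neg_zero])
    rw [h2] at h1
    exact neg_eq_zero.mp h1.symm
  have hQc : IsCompactOperator Q := hcomp (ρ ∘L B)
  refine ⟨n, Q, hQc, ?_, ?_, hunit Q hQc hQS hQid, fun T hT => ?_⟩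
  · ext x; exact hQid _ (hQS x)
  · ext x; exact hQS x
  · have hTS : T * S = S * T := ((Commute.one_right T).sub_right hT).pow_right (n + 1)
    have hTS' (x : X) : T (S x) = S (T x) := congrArg (fun U : X →L[ℂ] X => U x) hTS
    have hdec (x : X) : x = S (B x) + Q x := (hB x).symm
    ext x
    change T (Q x) = Q (T x)
    conv_rhs => rw [hdec x]
    rw [map_add, map_add, hTS', hQran, zero_add, hQid (T (Q x)) (by rw [← hTS', hQS, map_zero])]

/-- `1 - K` is Fredholm for compact `K`: it is invertible modulo its Riesz idempotent, which has
finite rank. -/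
theorem exists_quasiInverse_one_sub {K : X →L[ℂ] X} (hK : IsCompactOperator K) :
    ∃ W : X →L[ℂ] X, W.IsQuasiInverse (1 - K : X →L[ℂ] X) := by
  obtain ⟨n, Q, hQ, hQQ, hSQ, ⟨V, hV⟩, hcom⟩ := exists_riesz_idempotent hK
  have hc : Commute (1 - K) ((1 - K) ^ (n + 1) + Q) :=
    (Commute.self_pow _ _).add_right (hcom _ ((Commute.one_left K).sub_left (Commute.refl K)))
  rw [← hV] at hc
  have hQV : Q * ↑V = Q := by
    have : Commute ((1 - K) ^ (n + 1)) Q :=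
      (hcom _ ((Commute.one_left K).sub_left (Commute.refl K))).pow_left _
    rw [hV, mul_add, hQQ, ← this.eq, hSQ, zero_add]
  have hQV' : Q * ↑V⁻¹ = Q := by
    rw [Units.mul_inv_eq_iff_eq_mul, hQV]
  have h1 : (1 - K) * ((1 - K) ^ n * ↑V⁻¹) = 1 - Q := by
    rw [← mul_assoc, ← pow_succ', eq_sub_of_add_eq hV.symm, sub_mul, V.mul_inv, hQV']
  have h2 : ((1 - K) ^ n * ↑V⁻¹) * (1 - K) = 1 - Q := by
    rw [mul_assoc, ← hc.units_inv_right.eq, ← mul_assoc, ← pow_succ, pow_succ', mul_assoc, h1]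
  have hfr := hasFiniteRange_of_compact_idempotent hQ hQQ
  have hid : ((1 - Q : X →L[ℂ] X) : X →ₗ[ℂ] X) ≈ LinearMap.id := by
    rw [equiv_iff_hasFiniteRange]
    have he : ((1 - Q : X →L[ℂ] X) : X →ₗ[ℂ] X) - LinearMap.id = -(Q : X →ₗ[ℂ] X) := by
      ext x; simp
    rw [he]
    exact hfr.neg
  refine ⟨(1 - K) ^ n * ↑V⁻¹, ?_, ?_⟩
  · rw [← h2] at hid
    exact hid
  · rw [← h1] at hid
    exact hid

/-- An operator invertible modulo compact operators is Fredholm: it has left and right inverses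
modulo operators of finite rank, and these agree modulo operators of finite rank. -/
theorem isFredholm_of_isCompactOperator {U V : X →L[ℂ] X}
    (h₁ : IsCompactOperator (1 - U * V : X →L[ℂ] X))
    (h₂ : IsCompactOperator (1 - V * U : X →L[ℂ] X)) :
    U.IsFredholm := by
  obtain ⟨W₁, -, hr⟩ := exists_quasiInverse_one_sub h₁
  obtain ⟨W₂, hl, -⟩ := exists_quasiInverse_one_sub h₂
  rw [sub_sub_cancel] at hr hl
  have hR : (U : X →ₗ[ℂ] X) ∘ₗ ((V * W₁ : X →L[ℂ] X) : X →ₗ[ℂ] X) ≈ LinearMap.id := hr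
  have hL : ((W₂ * V : X →L[ℂ] X) : X →ₗ[ℂ] X) ∘ₗ (U : X →ₗ[ℂ] X) ≈ LinearMap.id := hl
  refine ContinuousLinearMap.IsFredholm.of_isQuasiInverse (v := W₂ * V) ⟨hL, ?_⟩
  change (U : X →ₗ[ℂ] X) ∘ₗ ((W₂ * V : X →L[ℂ] X) : X →ₗ[ℂ] X) ≈ LinearMap.id
  generalize ((V * W₁ : X →L[ℂ] X) : X →ₗ[ℂ] X) = R at hR
  generalize ((W₂ * V : X →L[ℂ] X) : X →ₗ[ℂ] X) = L at hL ⊢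
  have e₁ : L ∘ₗ ((U : X →ₗ[ℂ] X) ∘ₗ R) ≈ L := equiv_comp_left hR
  have e₂ : L ∘ₗ ((U : X →ₗ[ℂ] X) ∘ₗ R) ≈ R := equiv_comp_right (u := R) hL
  exact Setoid.trans (equiv_comp_left (Setoid.trans (Setoid.symm e₁) e₂)) hR

/-- **Atkinson's theorem**: an operator is Fredholm if and only if its class in the Calkin algebra is
invertible. -/
theorem isFredholm_iff_isUnit {U : X →L[ℂ] X} :
    U.IsFredholm ↔ IsUnit (calkinMap X U) := by
  constructor
  · intro hU
    obtain ⟨V, hl, hr⟩ := hU.exists_isQuasiInverse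
    have key (W : X →L[ℂ] X) (hW : (W : X →ₗ[ℂ] X) ≈ LinearMap.id) : calkinMap X W = 1 := by
      rw [← map_one (calkinMap X), calkinMap_eq_iff]
      refine isCompactOperator_of_hasFiniteRange ?_
      rw [equiv_iff_hasFiniteRange] at hW
      exact hW
    refine isUnit_iff_exists.mpr ⟨calkinMap X V, ?_, ?_⟩
    · rw [← map_mul]; exact key (U * V) hr
    · rw [← map_mul]; exact key (V * U) hl
  · intro hU
    obtain ⟨v, h₁, h₂⟩ := isUnit_iff_exists.mp hU
    obtain ⟨V, rfl⟩ := calkinMap_surjective v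
    rw [← map_mul, eq_comm, ← map_one (calkinMap X), calkinMap_eq_iff] at h₁ h₂
    exact isFredholm_of_isCompactOperator h₁ h₂

end Riesz

/-! ### Lifting idempotents from the Calkin algebra -/

section IdempotentLifting

variable {X : Type*} [NormedAddCommGroup X] [NormedSpace ℂ X] [CompleteSpace X]

/-- The part of the spectrum of a compact operator `K` outside a disc can be split off by a compact
idempotent commuting with everything that commutes with `K`. -/
theorem exists_compact_idempotent_notMem_spectrum {K : X →L[ℂ] X} (hK : IsCompactOperator K)
    {ε : ℝ} (hε : 0 < ε) : ∃ Q : X →L[ℂ] X, IsCompactOperator Q ∧ Q * Q = Q ∧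
      (∀ T, Commute T K → Commute T Q) ∧
      ∀ μ : ℂ, ε ≤ ‖μ‖ → μ ∉ spectrum ℂ (K * (1 - Q)) := by
  have hfin := hK.finite_eigenvalues_norm_ge hε
  -- `q` vanishes at the eigenvalues to be removed and `q 0 = 1`, so that `q(K) = 1 - L` with `L`
  -- compact; the Riesz idempotent of `L` removes all of these eigenvalues at once.
  let q : Polynomial ℂ := ∏ μ ∈ hfin.toFinset, (Polynomial.C 1 - Polynomial.C μ⁻¹ * Polynomial.X)
  let L : X →L[ℂ] X := 1 - Polynomial.aeval K q
  have hL : IsCompactOperator L := by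
    rw [← calkinMap_eq_zero_iff]
    have hK0 : calkinMap X K = 0 := calkinMap_eq_zero_iff.mpr hK
    rw [map_sub, map_one, ← Polynomial.aeval_algHom_apply, hK0,
      ← Polynomial.coeff_zero_eq_aeval_zero', Polynomial.coeff_zero_eq_eval_zero,
      Polynomial.eval_prod]
    simp
  have hLq : 1 - L = Polynomial.aeval K q := sub_sub_cancel _ _
  obtain ⟨n, Q, hQ, hQQ, hSQ, hunit, hcom⟩ := exists_riesz_idempotent hL
  have hcom' (T : X →L[ℂ] X) (hT : Commute T K) : Commute T Q := by
    refine hcom T ((Commute.one_right T).sub_right ?_)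
    rw [Polynomial.aeval_eq_sum_range]
    exact Commute.sum_right _ _ _ fun i _ => (hT.pow_right i).smul_right _
  refine ⟨Q, hQ, hQQ, hcom', fun μ hμ hmem => ?_⟩
  have hμ0 : μ ≠ 0 := norm_pos_iff.mp (hε.trans_le hμ)
  have hKc : IsCompactOperator (K * (1 - Q) : X →L[ℂ] X) := hK.comp_clm (1 - Q)
  obtain ⟨v, hv⟩ := ((hKc.hasEigenvalue_iff_mem_spectrum hμ0).mpr hmem).exists_hasEigenvector
  have hv1 : K (v - Q v) = μ • v := hv.apply_eq_smul
  have hQK (x : X) : Q (K x) = K (Q x) :=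
    congrArg (fun U : X →L[ℂ] X => U x) (hcom' K (Commute.refl K)).eq.symm
  have hQQ' (x : X) : Q (Q x) = Q x := congrArg (fun U : X →L[ℂ] X => U x) hQQ
  -- An eigenvector `v` of `K (1 - Q)` for `μ` is killed by `Q`, hence is an eigenvector of `K`, hence
  -- is killed by `q(K)`; but a power of `q(K)` plus `Q` is injective.
  have hQv : Q v = 0 := by
    have := congrArg Q hv1
    rw [hQK, map_sub, hQQ', sub_self, map_zero, map_smul, eq_comm, smul_eq_zero] at this
    exact this.resolve_left hμ0
  have hKv : Module.End.HasEigenvector (K : Module.End ℂ X) μ v := by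
    rw [hQv, sub_zero] at hv1
    exact ⟨Module.End.mem_eigenspace_iff.mpr hv1, hv.2⟩
  have hqμ : q.eval μ = 0 := by
    rw [Polynomial.eval_prod]
    refine Finset.prod_eq_zero (i := μ) ?_ (by simp [hμ0])
    exact hfin.mem_toFinset.mpr ⟨Module.End.hasEigenvalue_of_hasEigenvector hKv, hμ⟩
  have hSv : (1 - L) v = 0 := by
    have h1 := Module.End.aeval_apply_of_hasEigenvector (p := q) hKv
    have h2 : Polynomial.aeval (K : Module.End ℂ X) q =
        ((Polynomial.aeval K q : X →L[ℂ] X) : X →ₗ[ℂ] X) :=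
      Polynomial.aeval_algHom_apply
        ({ ContinuousLinearMap.toLinearMapRingHom with commutes' := fun _ => rfl } :
          (X →L[ℂ] X) →ₐ[ℂ] Module.End ℂ X) K q
    rw [h2, hqμ, zero_smul] at h1
    rw [hLq]
    exact h1
  obtain ⟨V, hV⟩ := hunit
  have hVv : (V : X →L[ℂ] X) v = 0 := by
    rw [hV, add_apply, hQv, pow_succ, mul_apply_eq_comp, hSv, map_zero, add_zero]
  have := congrArg (fun U : X →L[ℂ] X => U v) V.inv_mul
  rw [mul_apply_eq_comp, hVv, map_zero] at this
  exact hv.2 this.symm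

/-- Idempotents of the Calkin algebra lift to idempotent operators. -/
theorem exists_idempotent_lift {T : X →L[ℂ] X} (hT : IsCompactOperator (T * T - T : X →L[ℂ] X)) :
    ∃ E : X →L[ℂ] X, E * E = E ∧ calkinMap X E = calkinMap X T := by
  obtain ⟨Q, hQ, hQQ, hQcom, hQspec⟩ :=
    exists_compact_idempotent_notMem_spectrum hT (ε := 8⁻¹) (by norm_num)
  have hTQ : T * Q = Q * T :=
    hQcom T (((Commute.refl T).mul_right (Commute.refl T)).sub_right (Commute.refl T))
  set T' := T * (1 - Q) with hT'
  set k := (T * T - T) * (1 - Q) with hk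
  have hTk : T' * T' - T' = k := by
    have h1 : (1 - Q) * T = T * (1 - Q) := by rw [sub_mul, mul_sub, hTQ]; simp
    have h2 : (1 - Q) * (1 - Q) = 1 - Q := by
      rw [mul_sub, mul_one, sub_mul, one_mul, hQQ]; simp
    have h3 : T' * T' = T * T * (1 - Q) := by
      rw [hT', mul_assoc, ← mul_assoc (1 - Q), h1, mul_assoc, h2, ← mul_assoc]
    rw [h3, hk, hT', sub_mul]
  have hrad : spectralRadius ℂ k < 4⁻¹ := by
    have : spectralRadius ℂ k ≤ 8⁻¹ := by
      refine iSup₂_le fun μ hμ => ?_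
      by_contra! hlt
      refine hQspec μ ?_ hμ
      have h8 : ((8⁻¹ : NNReal) : ENNReal) < ‖μ‖₊ := by
        convert hlt using 1
        norm_num
      rw [ENNReal.coe_lt_coe] at h8
      exact_mod_cast h8.le
    refine this.trans_lt ?_
    rw [ENNReal.inv_lt_inv]
    norm_num
  obtain ⟨c, hc, hroot, V, hV⟩ := exists_quadratic_root hrad
  set u := k * c with hu
  have hT'k : Commute T' k := by
    rw [← hTk]
    exact ((Commute.refl T').mul_right (Commute.refl T')).sub_right (Commute.refl T')
  have hT'u : Commute T' u := hT'k.mul_right (hc _ hT'k)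
  have hTV : Commute (T' + u) V := by
    rw [hV]
    exact (Commute.one_right _).add_right
      ((Commute.ofNat_right _ 2).mul_right (hT'u.add_left (Commute.refl u)))
  -- Equivalent to `(T' + u) (T' - 1 - u) = T'² - T' - (u² + u) = 0`.
  have hsq : (T' + u) * (T' + u) = (T' + u) * V := by
    have h1 : T' * T' = T' + (u * u + u) := by rw [hroot, ← hTk]; abel
    rw [hV]
    simp only [add_mul, mul_add, h1, mul_one, two_mul, hT'u.eq]
    abel
  have hk0 : calkinMap X k = 0 := by
    have : IsCompactOperator k := hT.comp_clm (1 - Q)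
    exact calkinMap_eq_zero_iff.mpr this
  have hu0 : calkinMap X u = 0 := by rw [hu, map_mul, hk0, zero_mul]
  have hQ0 : calkinMap X Q = 0 := calkinMap_eq_zero_iff.mpr hQ
  have hV1 : calkinMap X (V⁻¹ : (X →L[ℂ] X)ˣ) = 1 := by
    have h1 : calkinMap X (V : X →L[ℂ] X) = 1 := by
      rw [hV, map_add, map_mul, hu0, mul_zero, add_zero, map_one]
    have h2 := congrArg (calkinMap X) V.mul_inv
    rwa [map_mul, h1, one_mul, map_one] at h2
  refine ⟨(T' + u) * (V⁻¹ : (X →L[ℂ] X)ˣ), ?_, ?_⟩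
  · rw [mul_assoc, ← mul_assoc _ (T' + u), ← hTV.units_inv_right.eq, ← mul_assoc, ← mul_assoc, hsq,
      Units.mul_inv_cancel_right]
  · rw [map_mul, hV1, mul_one, map_add, hu0, add_zero, hT', map_mul, map_sub, hQ0, map_one,
      sub_zero, mul_one]

end IdempotentLifting

/-! ### Operators on a complemented subspace -/

section Complemented

variable {X : Type*} [NormedAddCommGroup X] [NormedSpace ℂ X]

section Corner

variable {M N : Submodule ℂ X}

/-- For a topological direct sum `X = M ⊕ N`, the extension by zero on `N` of operators on `M`, as a
homomorphism of non-unital algebras from `L(M)` to `L(X)`. It sends `1` to the projection onto `M`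
along `N`. -/
noncomputable def corner (h : Submodule.IsTopCompl M N) : (M →L[ℂ] M) →ₙₐ[ℂ] (X →L[ℂ] X) where
  toFun A := M.subtypeL ∘L A ∘L M.projectionOntoL N h
  map_smul' c A := by ext x; simp
  map_zero' := by ext x; simp
  map_add' A B := by ext x; simp
  map_mul' A B := by
    ext x
    simp

/-- The compression to `M` of an operator on `X = M ⊕ N`: its restriction to `M`, followed by the
projection onto `M` along `N`. -/
noncomputable def compress (h : Submodule.IsTopCompl M N) (U : X →L[ℂ] X) : M →L[ℂ] M :=
  M.projectionOntoL N h ∘L U ∘L M.subtypeL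

variable (h : Submodule.IsTopCompl M N)

theorem corner_apply (A : M →L[ℂ] M) (x : X) :
    corner h A x = A (M.projectionOntoL N h x) := rfl

theorem corner_compress (U : X →L[ℂ] X) : corner h (compress h U) = corner h 1 * U * corner h 1 :=
  rfl

theorem compress_corner (A : M →L[ℂ] M) : compress h (corner h A) = A := by
  ext x; simp [compress, corner_apply]

theorem corner_mul_corner_symm (A : M →L[ℂ] M) (B : N →L[ℂ] N) :
    corner h A * corner h.symm B = 0 := by
  ext x; simp [corner_apply]

theorem corner_one_add_corner_symm_one : corner h 1 + corner h.symm 1 = 1 := by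
  ext x
  simpa [corner_apply] using Submodule.projection_add_projection_eq_self h.isCompl x

theorem corner_restrict {T : X →L[ℂ] X} (hM : ∀ x ∈ M, T x ∈ M) :
    corner h (T.restrict hM) = T * corner h 1 := rfl

theorem corner_restrict_eq_one_mul {T : X →L[ℂ] X} (hM : ∀ x ∈ M, T x ∈ M)
    (hN : ∀ x ∈ N, T x ∈ N) :
    corner h (T.restrict hM) = corner h 1 * T := by
  have h1 := corner_mul_corner_symm h 1 (T.restrict hN)
  rw [corner_restrict] at h1
  calc corner h (T.restrict hM) = corner h 1 * corner h (T.restrict hM) := by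
        rw [← map_mul, one_mul]
    _ = corner h 1 * (T * (corner h 1 + corner h.symm 1)) := by
        rw [mul_add, mul_add, h1, add_zero, corner_restrict]
    _ = corner h 1 * T := by rw [corner_one_add_corner_symm_one, mul_one]

theorem corner_restrict_mul {T : X →L[ℂ] X} (hM : ∀ x ∈ M, T x ∈ M) (A : M →L[ℂ] M) :
    corner h (T.restrict hM * A) = T * corner h A := by
  rw [map_mul, corner_restrict, mul_assoc, ← map_mul, one_mul]

theorem corner_restrict_pow {T : X →L[ℂ] X} (hM : ∀ x ∈ M, T x ∈ M) (n : ℕ) :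
    corner h (T.restrict hM ^ n) = T ^ n * corner h 1 := by
  induction n with
  | zero => rw [pow_zero, pow_zero, one_mul]
  | succ n ih => rw [pow_succ', corner_restrict_mul, ih, pow_succ', mul_assoc]

theorem calkinMap_corner_eq_iff {A B : M →L[ℂ] M} :
    calkinMap X (corner h A) = calkinMap X (corner h B) ↔ calkinMap M A = calkinMap M B := by
  rw [calkinMap_eq_iff, calkinMap_eq_iff, ← map_sub]
  refine ⟨fun hc => ?_, fun hc => (hc.comp_clm (M.projectionOntoL N h)).clm_comp M.subtypeL⟩
  rw [← compress_corner h (A - B)]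
  exact (hc.comp_clm M.subtypeL).clm_comp (M.projectionOntoL N h)

theorem calkinMap_pow_mul_corner_one_eq_zero_iff {T : X →L[ℂ] X} (hM : ∀ x ∈ M, T x ∈ M)
    (n : ℕ) : calkinMap X (T ^ n * corner h 1) = 0 ↔
      IsCompactOperator (T.restrict hM ^ n : M →L[ℂ] M) := by
  rw [← calkinMap_eq_zero_iff, ← corner_restrict_pow h hM, ← map_zero (calkinMap M),
    ← calkinMap_corner_eq_iff h, map_zero (corner h), map_zero]

end Corner

/-- On the range of the idempotent `π (corner h 1)` the nonzero spectrum of `π (corner h A)` is that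
of `π A`, and on the complementary part `π (corner h A)` is zero. -/
theorem isRiesz_iff_corner {M N : Submodule ℂ X} (h : Submodule.IsTopCompl M N)
    {A : M →L[ℂ] M} : IsRiesz A ↔ IsQuasinilpotent (calkinMap X (corner h A)) := by
  rw [IsRiesz, isQuasinilpotent_iff_isUnit, isQuasinilpotent_iff_isUnit]
  refine forall₂_congr fun z hz => ?_
  have hz1 : (z • 1 - calkinMap M A) = calkinMap M (z • 1 - A) := by
    rw [map_sub, map_smul, map_one]
  have hz2 : (z • 1 - calkinMap X (corner h A)) =
      calkinMap X (corner h (z • 1 - A) + z • corner h.symm 1) := by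
    rw [map_sub, map_smul, ← map_one (calkinMap X), ← map_smul, ← map_sub,
      ← corner_one_add_corner_symm_one h, smul_add]
    congr 1; abel
  rw [hz1, hz2]
  have h0 (A : M →L[ℂ] M) (B : N →L[ℂ] N) : corner h.symm B * corner h A = 0 :=
    corner_mul_corner_symm h.symm B A
  constructor
  · intro hu
    obtain ⟨r, h₁, h₂⟩ := isUnit_iff_exists.mp hu
    obtain ⟨R, rfl⟩ := calkinMap_surjective r
    rw [← map_mul, ← map_one (calkinMap M), ← calkinMap_corner_eq_iff h] at h₁ h₂
    refine isUnit_iff_exists.mpr ⟨calkinMap X (corner h R + z⁻¹ • corner h.symm 1), ?_, ?_⟩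
    · rw [← map_mul, add_mul, mul_add, mul_add, mul_smul_comm, smul_mul_assoc, smul_mul_smul_comm,
        corner_mul_corner_symm, h0, mul_inv_cancel₀ hz, ← map_mul, ← map_mul, one_mul]
      simp only [smul_zero, add_zero, zero_add, one_smul]
      rw [map_add, h₁, ← map_add, corner_one_add_corner_symm_one, map_one]
    · rw [← map_mul, add_mul, mul_add, mul_add, mul_smul_comm, smul_mul_assoc, smul_mul_smul_comm,
        corner_mul_corner_symm, h0, inv_mul_cancel₀ hz, ← map_mul, ← map_mul, one_mul]
      simp only [smul_zero, add_zero, zero_add, one_smul]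
      rw [map_add, h₂, ← map_add, corner_one_add_corner_symm_one, map_one]
  · intro hu
    obtain ⟨r, h₁, h₂⟩ := isUnit_iff_exists.mp hu
    obtain ⟨R, rfl⟩ := calkinMap_surjective r
    set D := corner h (z • 1 - A) + z • corner h.symm 1 with hD
    have e₁ : corner h (z • 1 - A) = corner h 1 * D := by
      rw [hD, mul_add, mul_smul_comm, corner_mul_corner_symm, ← map_mul, one_mul]; simp
    have e₂ : corner h (z • 1 - A) = D * corner h 1 := by
      rw [hD, add_mul, smul_mul_assoc, h0, ← map_mul, mul_one]; simp
    have e : corner h 1 * corner h 1 = corner h 1 := by rw [← map_mul, one_mul]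
    have e' : calkinMap X (corner h 1) * calkinMap X (corner h 1) = calkinMap X (corner h 1) := by
      rw [← map_mul, e]
    refine isUnit_iff_exists.mpr ⟨calkinMap M (compress h R), ?_, ?_⟩
    · rw [← map_mul, ← map_one (calkinMap M), ← calkinMap_corner_eq_iff h, map_mul (corner h),
        corner_compress]
      have : corner h (z • 1 - A) * (corner h 1 * R * corner h 1) =
          corner h 1 * (D * R) * corner h 1 := by
        rw [← mul_assoc, ← mul_assoc, ← map_mul, mul_one, e₁]
        simp only [mul_assoc]
      rw [this, map_mul, map_mul, map_mul _ D, h₁, mul_one, e']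
    · rw [← map_mul, ← map_one (calkinMap M), ← calkinMap_corner_eq_iff h, map_mul (corner h),
        corner_compress]
      have : (corner h 1 * R * corner h 1) * corner h (z • 1 - A) =
          corner h 1 * (R * D) * corner h 1 := by
        rw [mul_assoc, ← map_mul, one_mul, e₂]
        simp only [mul_assoc]
      rw [this, map_mul, map_mul, map_mul _ R, h₂, mul_one, e']

/-- The inverse of `T|_N` modulo compacts, extended by zero on `M`, inverts `π T` up to the class of
the projection onto `N`. -/
theorem exists_inverse_mod_corner {T : X →L[ℂ] X} {M N : Submodule ℂ X} (h : M.IsTopCompl N)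
    (hM : ∀ x ∈ M, T x ∈ M) (hN : ∀ x ∈ N, T x ∈ N)
    [CompleteSpace N] (hF : (T.restrict hN).IsFredholm) :
    ∃ b, calkinMap X T * b = calkinMap X (corner h.symm 1) ∧
      b * calkinMap X T = calkinMap X (corner h.symm 1) ∧
      b * calkinMap X (corner h.symm 1) = b := by
  obtain ⟨s, h₁, h₂⟩ := isUnit_iff_exists.mp (isFredholm_iff_isUnit.mp hF)
  obtain ⟨S, rfl⟩ := calkinMap_surjective s
  rw [← map_mul, ← map_one (calkinMap N), ← calkinMap_corner_eq_iff h.symm] at h₁ h₂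
  have e₁ : T * corner h.symm S = corner h.symm (T.restrict hN * S) := by
    rw [map_mul, corner_restrict, mul_assoc, ← map_mul, one_mul]
  have e₂ : corner h.symm S * T = corner h.symm (S * T.restrict hN) := by
    rw [map_mul, corner_restrict_eq_one_mul h.symm hN hM, ← mul_assoc, ← map_mul, mul_one]
  refine ⟨calkinMap X (corner h.symm S), ?_, ?_, ?_⟩
  · rw [← map_mul, e₁, h₁]
  · rw [← map_mul, e₂, h₂]
  · rw [← map_mul, ← map_mul, mul_one]

end Complemented

/-! ### Images of Riesz-Fredholm and power compact-Fredholm operators -/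

section Images

variable {X : Type*} [NormedAddCommGroup X] [NormedSpace ℂ X] [CompleteSpace X]

theorem mapsTo_calkinMap_rieszFredholm :
    Set.MapsTo (calkinMap X) (rieszFredholm X) (kolihaDrazinInvertible (Calkin X)) := by
  rintro T ⟨M, N, hMc, hNc, hMN, hM, hN, hR, hF⟩
  have h : M.IsTopCompl N := Submodule.IsCompl.isTopCompl_of_isClosed hMN hMc hNc
  have : CompleteSpace N := hNc.completeSpace_coe
  obtain ⟨b, h₁, h₂, h₃⟩ := exists_inverse_mod_corner h hM hN hF
  refine ⟨b, -calkinMap X (corner h (T.restrict hM)), h₁.trans h₂.symm, ?_, ?_,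
    ((isRiesz_iff_corner h).mp hR).neg⟩
  · rw [mul_assoc, h₁, h₃]
  · rw [mul_assoc, h₂, ← sub_eq_add_neg, eq_sub_iff_add_eq, ← map_mul, ← map_add,
      corner_restrict, ← mul_add, add_comm, corner_one_add_corner_symm_one, mul_one]

theorem mapsTo_calkinMap_powerCompactFredholm :
    Set.MapsTo (calkinMap X) (powerCompactFredholm X) (drazinInvertible (Calkin X)) := by
  rintro T ⟨M, N, hMc, hNc, hMN, hM, hN, ⟨n, -, hn⟩, hF⟩
  have h : M.IsTopCompl N := Submodule.IsCompl.isTopCompl_of_isClosed hMN hMc hNc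
  have : CompleteSpace N := hNc.completeSpace_coe
  obtain ⟨b, h₁, h₂, h₃⟩ := exists_inverse_mod_corner h hM hN hF
  refine ⟨b, n, h₁.trans h₂.symm, ?_, ?_⟩
  · rw [mul_assoc, h₁, h₃]
  · have h0 := (calkinMap_pow_mul_corner_one_eq_zero_iff h hM n).mpr hn
    rw [mul_assoc, h₂, ← map_pow, ← map_mul]
    conv_rhs => rw [← mul_one (T ^ n), ← corner_one_add_corner_symm_one h, mul_add, map_add, h0,
      zero_add]

/-- If `b` is an outer inverse of `a` commuting with `a`, then `a` has a representative `T` reduced by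
a decomposition `M ⊕ N`, with `T|_N` Fredholm, for which the projection onto `M` represents the
idempotent `1 - ab`. -/
theorem exists_reducing_representative {a b : Calkin X} (hab : a * b = b * a)
    (hbab : b * a * b = b) :
    ∃ (T : X →L[ℂ] X) (M N : Submodule ℂ X) (h : M.IsTopCompl N) (_ : ∀ x ∈ M, T x ∈ M)
      (hN : ∀ x ∈ N, T x ∈ N), IsClosed (M : Set X) ∧ IsClosed (N : Set X) ∧
      calkinMap X T = a ∧ (T.restrict hN).IsFredholm ∧ calkinMap X (corner h 1) = 1 - a * b := by
  have hp : (a * b) * (a * b) = a * b := by rw [mul_assoc, ← mul_assoc b, hbab]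
  obtain ⟨E₀, hE₀⟩ := calkinMap_surjective (a * b)
  obtain ⟨E, hE, hEp⟩ := exists_idempotent_lift (T := E₀) (by
    rw [← calkinMap_eq_iff, map_mul, hE₀, hp])
  rw [hE₀] at hEp
  obtain ⟨T₀, rfl⟩ := calkinMap_surjective a
  obtain ⟨B, rfl⟩ := calkinMap_surjective b
  have hEE (x : X) : E (E x) = E x := congrArg (fun U : X →L[ℂ] X => U x) hE
  let N := E.range
  let M := E.ker
  have hMc : IsClosed (M : Set X) := E.isClosed_ker
  have hNc : IsClosed (N : Set X) := ContinuousLinearMap.IsIdempotentElem.isClosed_range hE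
  have hMN : IsCompl M N :=
    (LinearMap.IsIdempotentElem.isCompl (ContinuousLinearMap.IsIdempotentElem.toLinearMap hE)).symm
  have h : M.IsTopCompl N := Submodule.IsCompl.isTopCompl_of_isClosed hMN hMc hNc
  have hcN : corner h.symm 1 = E := by
    ext x
    change ((N.projectionOntoL M h.symm x : N) : X) = E x
    have hx : x = (E x) + (x - E x) := by abel
    have h1 : N.projectionOntoL M h.symm (E x) = ⟨E x, x, rfl⟩ :=
      N.projectionOntoL_apply_left h.symm ⟨E x, x, rfl⟩
    have h2 : N.projectionOntoL M h.symm (x - E x) = 0 :=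
      N.projectionOntoL_apply_right h.symm ⟨x - E x, by
        change E (x - E x) = 0
        rw [map_sub, hEE, sub_self]⟩
    conv_lhs => rw [hx, map_add, h1, h2, add_zero]
  have hcM : corner h 1 = 1 - E := by
    rw [eq_sub_iff_add_eq, ← hcN, corner_one_add_corner_symm_one]
  let T : X →L[ℂ] X := E * T₀ * E + (1 - E) * T₀ * (1 - E)
  have hET : E * T = E * T₀ * E := by
    have h1 : E * (1 - E) = 0 := by rw [mul_sub, mul_one, hE, sub_self]
    simp only [T, mul_add, ← mul_assoc, hE, h1, zero_mul, add_zero]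
  have hTE : T * E = E * T₀ * E := by
    have h1 : (1 - E) * E = 0 := by rw [sub_mul, one_mul, hE, sub_self]
    simp only [T, add_mul, mul_assoc, hE, h1, mul_zero, add_zero]
  have hTEx (x : X) : T (E x) = E (T x) :=
    congrArg (fun U : X →L[ℂ] X => U x) (hTE.trans hET.symm)
  have hM : ∀ x ∈ M, T x ∈ M := fun x hx => by
    have hx' : E x = 0 := hx
    change E (T x) = 0
    rw [← hTEx, hx', map_zero]
  have hN : ∀ x ∈ N, T x ∈ N := by
    rintro _ ⟨x, rfl⟩
    exact ⟨T x, (hTEx x).symm⟩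
  have hTa : calkinMap X T = calkinMap X T₀ := by
    have hpa : calkinMap X T₀ * calkinMap X B * calkinMap X T₀ =
        calkinMap X T₀ * (calkinMap X T₀ * calkinMap X B) := by
      rw [mul_assoc, ← hab]
    simp only [T, map_add, map_mul, map_sub, map_one, hEp]
    generalize calkinMap X T₀ * calkinMap X B = p at *
    generalize calkinMap X T₀ = a at *
    rw [sub_mul, one_mul, hpa, mul_assoc a, hp, ← mul_one_sub, mul_assoc, mul_sub, mul_one,
      sub_mul, one_mul, hp, sub_self, sub_zero, ← mul_add, add_sub_cancel, mul_one]
  refine ⟨T, M, N, h, hM, hN, hMc, hNc, hTa, ?_, by rw [hcM, map_sub, map_one, hEp]⟩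
  have : CompleteSpace N := hNc.completeSpace_coe
  rw [isFredholm_iff_isUnit]
  set a := calkinMap X T₀
  set b := calkinMap X B
  have hbp : b * (a * b) = b := by rw [← mul_assoc, hbab]
  have hpb : a * b * b = b := by rw [hab, hbab]
  refine isUnit_iff_exists.mpr ⟨calkinMap N (compress h.symm B), ?_, ?_⟩
  · rw [← map_mul, ← map_one (calkinMap N), ← calkinMap_corner_eq_iff h.symm,
      map_mul (corner h.symm), corner_compress, corner_restrict, hcN]
    simp only [map_mul, hTa, hEp]
    rw [hpb, hbp, mul_assoc, hpb]
  · rw [← map_mul, ← map_one (calkinMap N), ← calkinMap_corner_eq_iff h.symm,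
      map_mul (corner h.symm), corner_compress, corner_restrict, hcN]
    simp only [map_mul, hTa, hEp]
    rw [hpb, hbp, ← mul_assoc, ← hab, hp]

theorem surjOn_calkinMap_rieszFredholm :
    Set.SurjOn (calkinMap X) (rieszFredholm X) (kolihaDrazinInvertible (Calkin X)) := by
  rintro a ⟨b, w, hab, hbab, haba, hw⟩
  obtain ⟨T, M, N, h, hM, hN, hMc, hNc, rfl, hF, hp⟩ := exists_reducing_representative hab hbab
  refine ⟨T, ⟨M, N, hMc, hNc, h.isCompl, hM, hN, (isRiesz_iff_corner h).mpr ?_, hF⟩, rfl⟩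
  convert hw.neg using 1
  rw [corner_restrict, map_mul, hp, mul_sub, mul_one, hab, ← mul_assoc, haba]
  abel

theorem surjOn_calkinMap_powerCompactFredholm :
    Set.SurjOn (calkinMap X) (powerCompactFredholm X) (drazinInvertible (Calkin X)) := by
  rintro a ⟨b, m, hab, hbab, hm⟩
  obtain ⟨T, M, N, h, hM, hN, hMc, hNc, rfl, hF, hp⟩ := exists_reducing_representative hab hbab
  refine ⟨T, ⟨M, N, hMc, hNc, h.isCompl, hM, hN, ⟨m + 1, Nat.le_add_left 1 m, ?_⟩, hF⟩, rfl⟩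
  -- The exponent is `m + 1` since `m` may be zero, while power compactness asks for a positive one.
  rw [← calkinMap_pow_mul_corner_one_eq_zero_iff h hM, map_mul, map_pow, hp, hab, pow_succ',
    mul_assoc, mul_sub, ← mul_assoc (_ ^ m), hm, mul_one, sub_self, mul_zero]

end Images

end CalkinDrazin

theorem theorem3p11 (X : Type*) [NormedAddCommGroup X] [NormedSpace ℂ X] [CompleteSpace X] :
    (CalkinDrazin.calkinMap X '' CalkinDrazin.rieszFredholm X =
        CalkinDrazin.kolihaDrazinInvertible (CalkinDrazin.Calkin X) ∧
      CalkinDrazin.calkinMap X ⁻¹'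
          CalkinDrazin.kolihaDrazinInvertible (CalkinDrazin.Calkin X) =
        CalkinDrazin.rieszFredholm X + (CalkinDrazin.compactIdeal X : Set (X →L[ℂ] X))) ∧
    (CalkinDrazin.calkinMap X '' CalkinDrazin.powerCompactFredholm X =
        CalkinDrazin.drazinInvertible (CalkinDrazin.Calkin X) ∧
      CalkinDrazin.calkinMap X ⁻¹' CalkinDrazin.drazinInvertible (CalkinDrazin.Calkin X) =
        CalkinDrazin.powerCompactFredholm X +
          (CalkinDrazin.compactIdeal X : Set (X →L[ℂ] X))) := by
  have h₁ := CalkinDrazin.surjOn_calkinMap_rieszFredholm.image_eq_of_mapsTo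
    (CalkinDrazin.mapsTo_calkinMap_rieszFredholm (X := X))
  have h₂ := CalkinDrazin.surjOn_calkinMap_powerCompactFredholm.image_eq_of_mapsTo
    (CalkinDrazin.mapsTo_calkinMap_powerCompactFredholm (X := X))
  refine ⟨⟨h₁, ?_⟩, h₂, ?_⟩
  · rw [← h₁, CalkinDrazin.preimage_image_calkinMap]
  · rw [← h₂, CalkinDrazin.preimage_image_calkinMap]
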